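/- Let $q \ge 4$ be a prime power, let $n = q^2 - 1$, and let $i$ be an integer with $1 \le i \le q-3$. Then there exists a convolutional code over $\mathbb{F}_q$ with parameters $$(n,\; n-2(q+i),\; 2(q-2-i);\; 1,\; d_{free} \ge 2q+1)_q .$$ Here a convolutional code with parameters $(n,k,\gamma;\mu,d_{free})_q$ is a submodule $C=\{\mathbf{u}(D)G(D) : \mathbf{u}(D)\in\mathbb{F}_q[D]^k\}$ of $\mathbb{F}_q[D]^n$ generated by a reduced basic matrix $G(D)=(g_{lj})\in\mathbb{F}_q[D]^{k\times n}$ with $\gamma=\sum_{l=1}^k\gamma_l$ and $\mu=\max_{1\le l\le k}\gamma_l$, where $\gamma_l=\max_{1\le j\le n}\deg g_{lj}$, and $d_{free}$ is the minimum weight of a nonzero element of $C$, the weight of $\mathbf{v}(D)\in\mathbb{F}_q[D]^n$ being the total number of nonzero coefficients of its $n$ entries. The matrix $G(D)$ is basic if it has a polynomial right inverse, and a basic matrix is reduced if $\sum_l\gamma_l$ is smallest among all basic generator matrices of the same code. -/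

import Mathlib

namespace ConvCode

variable {F : Type*} [Field F] {k n : ℕ}

/-- The row degree `γ_i = max_j deg g_{ij}` of a polynomial matrix `G(D)`. -/
noncomputable def rowDegree (G : Matrix (Fin k) (Fin n) (Polynomial F)) (i : Fin k) : ℕ :=
  Finset.univ.sup fun j => (G i j).natDegree

/-- The overall constraint length `γ = ∑ i, γ_i` of a polynomial matrix. -/
noncomputable def constraintLength (G : Matrix (Fin k) (Fin n) (Polynomial F)) : ℕ :=
  ∑ i, rowDegree G i

/-- The memory `μ = max_i γ_i` of a polynomial matrix. -/
noncomputable def memory (G : Matrix (Fin k) (Fin n) (Polynomial F)) : ℕ :=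
  Finset.univ.sup fun i => rowDegree G i

/-- The submodule `{u(D) G(D) | u(D) ∈ F[D]^k}` of `F[D]^n` generated by `G(D)`. -/
noncomputable def code (G : Matrix (Fin k) (Fin n) (Polynomial F)) :
    Submodule (Polynomial F) (Fin n → Polynomial F) :=
  LinearMap.range G.vecMulLinear

/-- A polynomial encoder matrix is basic if it has a polynomial right inverse. -/
def IsBasic (G : Matrix (Fin k) (Fin n) (Polynomial F)) : Prop :=
  ∃ R : Matrix (Fin n) (Fin k) (Polynomial F), G * R = 1

/-- A basic generator matrix is reduced if its overall constraint length is the smallest among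
all basic generator matrices of the same code. (A basic matrix has independent rows, so all of
these have the same number `k` of rows.) -/
def IsReducedBasic (G : Matrix (Fin k) (Fin n) (Polynomial F)) : Prop :=
  IsBasic G ∧ ∀ G' : Matrix (Fin k) (Fin n) (Polynomial F),
    IsBasic G' → code G' = code G → constraintLength G ≤ constraintLength G'

/-- The Hamming weight of `v(D) ∈ F[D]^n`: the number of nonzero coefficients of its entries. -/
def weight (v : Fin n → Polynomial F) : ℕ :=
  ∑ j, (v j).support.card

/-- The free distance: the least weight of a nonzero codeword. -/
noncomputable def freeDistance (C : Submodule (Polynomial F) (Fin n → Polynomial F)) : ℕ :=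
  sInf {w | ∃ v ∈ C, v ≠ 0 ∧ weight v = w}

/-- `C` is a convolutional code with parameters `(n, k, γ; μ, d)` over `F`: it is generated by a
reduced basic `k × n` matrix of overall constraint length `γ` and memory `μ`, and its free
distance is `d`. -/
def HasParameters (C : Submodule (Polynomial F) (Fin n → Polynomial F)) (k γ μ d : ℕ) : Prop :=
  (∃ G : Matrix (Fin k) (Fin n) (Polynomial F),
    IsReducedBasic G ∧ code G = C ∧ constraintLength G = γ ∧ memory G = μ) ∧
  freeDistance C = d

end ConvCode

/-! Let `K` be the quadratic extension of `F` and let `x` list the nonzero elements of `K`.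
Exponents of power sums are written in base `q` as digit pairs. Frobenius swaps the digits, so a
swap-stable set `T` of pairs costs a word at most `T.card` linear conditions over `F`
(`le_finrank_powerSumCode`).

Two sets `T₀`, `T₁` of at most `2(q+i)` pairs define block codes `C₀`, `C₁`. By the BCH bound each
has distance at least `q+1`, from the exponents `0, …, q-1` and `q, …, 2q-1` respectively, while the
intersection has distance at least `2q+1`. The intersection has dimension exactly `n - (4q-4)`, the
upper bound coming from the complementary exponents (`finrank_powerSumCode_le`).

The encoder has a basis `z` of `C₀ ⊓ C₁` as constant rows, and rows `f + D e` with `f` in `C₀`, `e`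
in `C₁` and all the vectors independent. A nonzero codeword then starts in `C₀` and ends in `C₁`. If
the two ends differ it has weight at least `2(q+1)`; otherwise that coefficient lies in `C₀ ⊓ C₁`
(`IsDualPair.le_weight`). -/

open Module

/-! ### Coordinates on a quadratic extension of finite fields. -/

/-- Over a field extension `K / F` with `F` of size `q`, the elements of `K` fixed by `y ↦ y ^ q`
are those of `F`. -/
theorem FiniteField.exists_algebraMap_eq_of_pow_card {F K : Type*} [Field F] [Fintype F] [Field K]
    [Algebra F K] {y : K} (hy : y ^ Fintype.card F = y) : ∃ c : F, algebraMap F K c = y := by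
  classical
  have hne : (Polynomial.X ^ Fintype.card F - Polynomial.X : Polynomial K) ≠ 0 :=
    FiniteField.X_pow_card_sub_X_ne_zero K Fintype.one_lt_card
  set P : Polynomial K := Polynomial.X ^ Fintype.card F - Polynomial.X with hP
  have hsub : Finset.univ.image (algebraMap F K) ⊆ P.roots.toFinset := by
    intro z hz
    obtain ⟨c, -, rfl⟩ := Finset.mem_image.1 hz
    rw [Multiset.mem_toFinset, Polynomial.mem_roots hne]
    simp [hP, Polynomial.IsRoot, ← map_pow, FiniteField.pow_card]
  have hcard : P.roots.toFinset.card ≤ (Finset.univ.image (algebraMap F K)).card := by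
    rw [Finset.card_image_of_injective _ (algebraMap F K).injective, Finset.card_univ]
    calc P.roots.toFinset.card ≤ P.roots.card := Multiset.toFinset_card_le _
      _ ≤ P.natDegree := P.card_roots'
      _ = Fintype.card F := FiniteField.X_pow_card_sub_X_natDegree_eq K Fintype.one_lt_card
  have hmem : y ∈ P.roots.toFinset := by
    rw [Multiset.mem_toFinset, Polynomial.mem_roots hne]
    simp [hP, Polynomial.IsRoot, hy]
  rw [← Finset.eq_of_subset_of_card_le hsub hcard] at hmem
  simpa using hmem

/-- A quadratic extension of finite fields has two coordinates, the first of which is faithful on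
the ground field. -/
theorem FiniteField.exists_coordinates {F K : Type*} [Field F] [Fintype F] [Field K]
    [Algebra F K] (h2 : finrank F K = 2) : ∃ φ ψ : K →ₗ[F] F,
      (∀ y, y ^ Fintype.card F = y → φ y = 0 → y = 0) ∧ ∀ y, φ y = 0 → ψ y = 0 → y = 0 := by
  have : FiniteDimensional F K := FiniteDimensional.of_finrank_pos (by omega)
  obtain ⟨φ, hφ⟩ := Projective.exists_dual_eq_one F (one_ne_zero (α := K))
  have hker : finrank F (LinearMap.ker φ) = 1 := by
    have h := φ.finrank_range_add_finrank_ker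
    rw [LinearMap.range_eq_top.2 (LinearMap.surjective (f := φ) (by rintro rfl; simp at hφ)),
      finrank_top, finrank_self, h2] at h
    omega
  obtain ⟨u, hu0, hu⟩ := finrank_eq_one_iff'.1 hker
  -- The kernel of `φ` is the line through `u`, so a functional nonzero at `u` separates what `φ`
  -- misses.
  obtain ⟨ψ, hψ⟩ := Projective.exists_dual_eq_one F (x := (u : K)) (by simpa using hu0)
  refine ⟨φ, ψ, fun y hy h0 => ?_, fun y h0 h1 => ?_⟩
  · obtain ⟨c, rfl⟩ := FiniteField.exists_algebraMap_eq_of_pow_card hy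
    rw [Algebra.algebraMap_eq_smul_one, map_smul, hφ] at h0
    have : c = 0 := by simpa using h0
    simp [this]
  · obtain ⟨c, hc⟩ := hu ⟨y, h0⟩
    have hc' : c • (u : K) = y := congrArg Subtype.val hc
    rw [← hc', map_smul, hψ] at h1
    have : c = 0 := by simpa using h1
    rw [← hc', this, zero_smul]

/-! ### The BCH bound and codes cut out by power sums. -/

namespace ConvCode

/-- The BCH bound. -/
theorem lt_hammingNorm_of_powerSums_eq_zero {F K : Type*} [Field F] [DecidableEq F] [Field K]
    [Algebra F K] {n : ℕ} {x : Fin n → K}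
    (hx : Function.Injective x) (hx0 : ∀ j, x j ≠ 0) {v : Fin n → F} (hv : v ≠ 0) (b m : ℕ)
    (h : ∀ s < m, ∑ j, v j • x j ^ (b + s) = 0) : m < hammingNorm v := by
  classical
  by_contra! hm
  obtain ⟨j₀, hj₀⟩ := Function.ne_iff.1 hv
  set S := (Finset.univ.filter fun j => v j ≠ 0) with hS
  have hSm : S.card ≤ m := hm
  have hjS : j₀ ∈ S := by simpa [hS] using hj₀
  -- `P` vanishes at every support point except `x j₀`. Its degree is below `m`, so the weighted sum
  -- of its values combines the vanishing power sums, yet only the nonzero term at `j₀` survives.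
  let P : Polynomial K := ∏ j ∈ S.erase j₀, (Polynomial.X - Polynomial.C (x j))
  have hdeg : P.natDegree < m := by
    rw [Polynomial.natDegree_prod_of_monic _ _ fun j _ => Polynomial.monic_X_sub_C _]
    have := Finset.card_erase_of_mem hjS
    have := Finset.card_pos.2 ⟨_, hjS⟩
    simp
    omega
  have hP : ∑ j, v j • (x j ^ b * P.eval (x j)) = 0 := by
    simp_rw [Polynomial.eval_eq_sum_range' hdeg, Finset.mul_sum, Finset.smul_sum]
    rw [Finset.sum_comm]
    refine Finset.sum_eq_zero fun s hs => ?_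
    calc ∑ j, v j • (x j ^ b * (P.coeff s * x j ^ s))
        = P.coeff s * ∑ j, v j • x j ^ (b + s) := by
          rw [Finset.mul_sum]
          refine Finset.sum_congr rfl fun j _ => ?_
          rw [mul_smul_comm, pow_add, mul_left_comm]
      _ = 0 := by rw [h s (Finset.mem_range.1 hs), mul_zero]
  rw [Finset.sum_eq_single j₀] at hP
  · have hPj : P.eval (x j₀) ≠ 0 := by
      rw [Polynomial.eval_prod, Finset.prod_ne_zero_iff]
      intro j hj
      simpa [sub_eq_zero] using fun e => (Finset.ne_of_mem_erase hj) (hx e.symm)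
    exact smul_ne_zero hj₀ (mul_ne_zero (pow_ne_zero _ (hx0 _)) hPj) hP
  · intro j _ hj
    by_cases hvj : v j = 0
    · simp [hvj]
    · have : P.eval (x j) = 0 := by
        rw [Polynomial.eval_prod]
        exact Finset.prod_eq_zero (Finset.mem_erase.2 ⟨hj, by simpa [hS] using hvj⟩) (by simp)
      simp [this]
  · simp

/-- The words over `F` whose power sums at the points `x` with exponents `a + q b`, where
`q = |F|` and `(a, b) ∈ T`, vanish. -/
noncomputable def powerSumCode (F : Type*) {K : Type*} [Field F] [Fintype F] [Field K]
    [Algebra F K] {n : ℕ} (x : Fin n → K) (T : Finset (ℕ × ℕ)) : Submodule F (Fin n → F) :=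
  ⨅ p ∈ T, LinearMap.ker
    (Fintype.linearCombination F fun j => x j ^ (p.1 + Fintype.card F * p.2))

section

variable {F K : Type*} [Field F] [Fintype F] [Field K] [Algebra F K] {n : ℕ}

theorem mem_powerSumCode {x : Fin n → K} {T : Finset (ℕ × ℕ)} {v : Fin n → F} :
    v ∈ powerSumCode F x T ↔
      ∀ p ∈ T, ∑ j, v j • x j ^ (p.1 + Fintype.card F * p.2) = 0 := by
  simp [powerSumCode, Submodule.mem_iInf, Fintype.linearCombination_apply]

theorem powerSumCode_union (x : Fin n → K) (S T : Finset (ℕ × ℕ)) :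
    powerSumCode F x (S ∪ T) = powerSumCode F x S ⊓ powerSumCode F x T := by
  ext v
  simp only [Submodule.mem_inf, mem_powerSumCode, Finset.mem_union, or_imp, forall_and]

/-- Conjugation exchanges the two base-`q` digits of an exponent. -/
theorem powerSum_pow_card [Fintype K] (hK : Fintype.card K = Fintype.card F ^ 2)
    (x : Fin n → K) (v : Fin n → F) (a b : ℕ) :
    (∑ j, v j • x j ^ (a + Fintype.card F * b)) ^ Fintype.card F =
      ∑ j, v j • x j ^ (b + Fintype.card F * a) := by
  have h := map_sum (FiniteField.frobeniusAlgHom F K)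
    (fun j => v j • x j ^ (a + Fintype.card F * b)) Finset.univ
  simp only [map_smul, FiniteField.coe_frobeniusAlgHom] at h
  rw [h]
  refine Finset.sum_congr rfl fun j _ => ?_
  have hx : x j ^ Fintype.card F ^ 2 = x j := by rw [← hK, FiniteField.pow_card]
  congr 1
  rw [← pow_mul, add_mul, pow_add, pow_add, mul_right_comm, ← pow_two, pow_mul _ _ b, hx,
    mul_comm, mul_comm a]

/-- A `K`-valued condition costs two over `F`, but conjugate exponents give equivalent conditions:
`p` and `p.swap` can share the coordinates `φ` and `ψ` of a single sum. On the diagonal the sum is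
fixed by Frobenius, so `φ` alone detects it. -/
theorem le_finrank_powerSumCode [Fintype K] (h2 : finrank F K = 2)
    (hK : Fintype.card K = Fintype.card F ^ 2) (x : Fin n → K) {T : Finset (ℕ × ℕ)}
    (hT : ∀ p ∈ T, p.swap ∈ T) : n ≤ finrank F (powerSumCode F x T) + T.card := by
  obtain ⟨φ, ψ, hφ, hψ⟩ := FiniteField.exists_coordinates h2
  let s (p : ℕ × ℕ) : (Fin n → F) →ₗ[F] K :=
    Fintype.linearCombination F fun j => x j ^ (p.1 + Fintype.card F * p.2)
  have hs (p : ℕ × ℕ) (v : Fin n → F) :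
      s p v = ∑ j, v j • x j ^ (p.1 + Fintype.card F * p.2) :=
    Fintype.linearCombination_apply ..
  have hswap (p : ℕ × ℕ) (v : Fin n → F) : s p v ^ Fintype.card F = s p.swap v := by
    rw [hs, hs, powerSum_pow_card hK]; rfl
  let f : (Fin n → F) →ₗ[F] (T → F) :=
    LinearMap.pi fun p => if p.1.1 ≤ p.1.2 then φ ∘ₗ s p else ψ ∘ₗ s p.1.swap
  have hq : Fintype.card F ≠ 0 := Fintype.card_ne_zero
  have hle : LinearMap.ker f ≤ powerSumCode F x T := by
    intro v hv
    have hv' (p) (hp : p ∈ T) :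
        (if p.1 ≤ p.2 then φ ∘ₗ s p else ψ ∘ₗ s p.swap) v = 0 :=
      congrFun (LinearMap.mem_ker.1 hv) ⟨p, hp⟩
    have hlt (p) (hp : p ∈ T) (hlt : p.1 < p.2) : s p v = 0 := by
      refine hψ _ ?_ ?_
      · simpa [hlt.le] using hv' p hp
      · simpa [hlt.not_ge] using hv' p.swap (hT p hp)
    refine mem_powerSumCode.2 fun p hp => ?_
    rw [← hs]
    rcases lt_trichotomy p.1 p.2 with h | h | h
    · exact hlt p hp h
    · refine hφ _ ?_ ?_
      · rw [hswap]
        congr 2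
        exact Prod.ext h.symm h
      · simpa [h.le] using hv' p hp
    · rw [← pow_eq_zero_iff hq, hswap]
      exact hlt _ (hT p hp) h
  have h1 := f.finrank_range_add_finrank_ker
  have h3 := Submodule.finrank_mono hle
  have h4 := (LinearMap.range f).finrank_le
  simp only [finrank_fintype_fun_eq_card, Fintype.card_fin, Fintype.card_coe] at h1 h4
  omega

end

end ConvCode

/-! ### Linear algebra: families adapted to two subspaces, dual families, determinant degrees. -/

theorem Submodule.exists_disjoint_linearIndependent {F V : Type*} [Field F] [AddCommGroup V]
    [Module F V] [FiniteDimensional F V] {Z C : Submodule F V} (hZC : Z ≤ C) {g : ℕ}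
    (hg : finrank F Z + g ≤ finrank F C) :
    ∃ (E : Submodule F V) (e : Fin g → V), E ≤ C ∧ Disjoint Z E ∧ (∀ l, e l ∈ E) ∧
      LinearIndependent F e := by
  obtain ⟨W, hW⟩ := Z.exists_isCompl
  have hd : Disjoint Z (W ⊓ C) := hW.disjoint.mono_right inf_le_left
  have hsup : Z ⊔ W ⊓ C = C := by
    rw [← sup_inf_assoc_of_le W hZC, hW.sup_eq_top, top_inf_eq]
  have h := Submodule.finrank_sup_add_finrank_inf_eq Z (W ⊓ C)
  rw [hsup, hd.eq_bot, finrank_bot] at h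
  have hle : g ≤ finrank F ↥(W ⊓ C) := by omega
  let b := finBasis F ↥(W ⊓ C)
  refine ⟨W ⊓ C, fun l => b (Fin.castLE hle l), inf_le_right, hd, fun l => (b _).2, ?_⟩
  exact (b.linearIndependent.comp _ (Fin.castLE_injective hle)).map'
    (W ⊓ C).subtype (Submodule.ker_subtype _)

/-- Take `f` and `e` in complements `E₀`, `E₁` of the intersection inside `C₀` and `C₁`. If `y + w`
lies in the intersection with `y ∈ E₀`, `w ∈ E₁`, then `w` lies in `C₀` too, so `w = 0` and then `y
= 0`. -/
theorem Submodule.exists_linearIndependent_of_inf {F V : Type*} [Field F] [AddCommGroup V]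
    [Module F V] [FiniteDimensional F V] {C₀ C₁ : Submodule F V} {g r : ℕ}
    (hr : finrank F ↥(C₀ ⊓ C₁) = r) (h₀ : r + g ≤ finrank F C₀) (h₁ : r + g ≤ finrank F C₁) :
    ∃ (z : Fin r → V) (f e : Fin g → V), (∀ l, z l ∈ C₀ ⊓ C₁) ∧ (∀ l, f l ∈ C₀) ∧
      (∀ l, e l ∈ C₁) ∧ LinearIndependent F (Sum.elim z (Sum.elim f e)) := by
  subst hr
  obtain ⟨E₀, f, hE₀, hd₀, hf, hfi⟩ :=
    exists_disjoint_linearIndependent (inf_le_left : C₀ ⊓ C₁ ≤ C₀) h₀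
  obtain ⟨E₁, e, hE₁, hd₁, he, hei⟩ :=
    exists_disjoint_linearIndependent (inf_le_right : C₀ ⊓ C₁ ≤ C₁) h₁
  let b := finBasis F ↥(C₀ ⊓ C₁)
  have hspan {ι : Type} {w : ι → V} {E : Submodule F V} (h : ∀ l, w l ∈ E) :
      span F (Set.range w) ≤ E := span_le.2 (Set.range_subset_iff.2 h)
  refine ⟨fun l => b l, f, e, fun l => (b l).2, fun l => hE₀ (hf l), fun l => hE₁ (he l),
    (b.linearIndependent.map' (C₀ ⊓ C₁).subtype (ker_subtype _)).sum_type
      (hfi.sum_type hei ?_) ?_⟩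
  · refine Disjoint.mono (hspan hf) (hspan he) (disjoint_def.2 fun x hx₀ hx₁ => ?_)
    exact disjoint_def.1 hd₀ x ⟨hE₀ hx₀, hE₁ hx₁⟩ hx₀
  · have hle : span F (Set.range (Sum.elim f e)) ≤ E₀ ⊔ E₁ := hspan fun l => by
      rcases l with l | l
      · exact mem_sup_left (hf l)
      · exact mem_sup_right (he l)
    refine Disjoint.mono (hspan fun l => (b l).2) hle (disjoint_def.2 fun x hx hx' => ?_)
    obtain ⟨y, hy, w, hw, rfl⟩ := mem_sup.1 hx'
    have hw0 : w = 0 := disjoint_def.1 hd₁ w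
      ⟨by simpa using C₀.sub_mem hx.1 (hE₀ hy), hE₁ hw⟩ hw
    subst hw0
    rw [add_zero] at hx ⊢
    exact disjoint_def.1 hd₀ y hx hy

/-- A linearly independent family of vectors in `F ^ n` has a dual family of functionals. -/
theorem LinearIndependent.exists_dotProduct_eq {F ι : Type*} [Field F] [DecidableEq ι] {n : ℕ}
    {b : ι → Fin n → F} (hb : LinearIndependent F b) :
    ∃ c : ι → Fin n → F, ∀ i j, b i ⬝ᵥ c j = if i = j then 1 else 0 := by
  obtain ⟨g, hg⟩ := (Finsupp.linearCombination F b).exists_leftInverse_of_injective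
    (LinearMap.ker_eq_bot.2 hb)
  refine ⟨fun j k => g (Pi.single k 1) j, fun i j => ?_⟩
  have h : g (b i) = Finsupp.single i 1 := by
    simpa using LinearMap.congr_fun hg (Finsupp.single i 1)
  have h' : b i = ∑ k, b i k • (Pi.single k 1 : Fin n → F) := by
    ext l; simp [Finset.sum_apply, Pi.single_apply]
  rw [h', map_sum] at h
  have := DFunLike.congr_fun h j
  simpa [dotProduct, Finsupp.finsetSum_apply, Finsupp.single_apply] using this

theorem Matrix.natDegree_det_le {R ι : Type*} [CommRing R] [Fintype ι] [DecidableEq ι]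
    (M : Matrix ι ι (Polynomial R)) (d : ι → ℕ) (h : ∀ i j, (M i j).natDegree ≤ d i) :
    M.det.natDegree ≤ ∑ i, d i := by
  rw [← Matrix.det_transpose, Matrix.det_apply]
  refine Polynomial.natDegree_sum_le_of_forall_le _ _ fun σ _ => ?_
  refine (Polynomial.natDegree_smul_le _ _).trans ((Polynomial.natDegree_prod_le _ _).trans ?_)
  exact Finset.sum_le_sum fun i _ => h _ _

/-! ### Memory-one encoders: reducedness and weights of codewords. -/

namespace ConvCode

section

variable {F : Type*} [Field F] {k n : ℕ}

/-- The polynomial matrix `A + D B`. -/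
noncomputable def linearEncoder (A B : Matrix (Fin k) (Fin n) F) :
    Matrix (Fin k) (Fin n) (Polynomial F) :=
  A.map Polynomial.C + (Polynomial.X : Polynomial F) • B.map Polynomial.C

theorem linearEncoder_mul (A B : Matrix (Fin k) (Fin n) F) (P : Matrix (Fin n) (Fin k) F) :
    linearEncoder A B * P.map Polynomial.C =
      (A * P).map Polynomial.C + (Polynomial.X : Polynomial F) • (B * P).map Polynomial.C := by
  rw [linearEncoder, Matrix.add_mul, Matrix.smul_mul, ← Matrix.map_mul, ← Matrix.map_mul]

theorem exists_mul_eq_of_code_le {G G' : Matrix (Fin k) (Fin n) (Polynomial F)}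
    (h : code G' ≤ code G) : ∃ U : Matrix (Fin k) (Fin k) (Polynomial F), U * G = G' := by
  have h' (l : Fin k) : ∃ u, Matrix.vecMul u G = G' l := by
    have : G' l ∈ code G' := ⟨Pi.single l 1, by ext; simp⟩
    simpa [code] using h this
  choose u hu using h'
  exact ⟨Matrix.of u, funext fun l => (Matrix.mul_apply_eq_vecMul _ _ _).trans (hu l)⟩

/-- A basic matrix `G` is reduced if some constant matrix makes `det (G Q)` have degree at least
the overall constraint length of `G`. -/
theorem isReducedBasic_of_le_natDegree_det {G : Matrix (Fin k) (Fin n) (Polynomial F)}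
    (hG : IsBasic G) (Q : Matrix (Fin n) (Fin k) F) (hQ : (G * Q.map Polynomial.C).det ≠ 0)
    (hdeg : constraintLength G ≤ (G * Q.map Polynomial.C).det.natDegree) :
    IsReducedBasic G := by
  refine ⟨hG, fun G' _ hcode => hdeg.trans ?_⟩
  obtain ⟨U, rfl⟩ := exists_mul_eq_of_code_le hcode.le
  obtain ⟨W, hW⟩ := exists_mul_eq_of_code_le hcode.ge
  obtain ⟨R, hR⟩ := hG
  have hWU : W * U = 1 := by
    have : W * U * (G * R) = G * R := by rw [← Matrix.mul_assoc, Matrix.mul_assoc W, hW]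
    rwa [hR, Matrix.mul_one] at this
  have hU : U.det ≠ 0 := by
    intro h
    have := congrArg Matrix.det hWU
    simp [Matrix.det_mul, h] at this
  -- Passing to `U * G` multiplies the determinant by the nonzero `U.det`, so its degree cannot
  -- drop; expanding the new determinant bounds that degree by the row degrees of `U * G`.
  calc (G * Q.map Polynomial.C).det.natDegree
      ≤ U.det.natDegree + (G * Q.map Polynomial.C).det.natDegree := Nat.le_add_left _ _
    _ = ((U * G) * Q.map Polynomial.C).det.natDegree := by
      rw [Matrix.mul_assoc, Matrix.det_mul, Polynomial.natDegree_mul hU hQ]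
    _ ≤ constraintLength (U * G) := by
      refine Matrix.natDegree_det_le _ _ fun i j => ?_
      rw [Matrix.mul_apply]
      refine Polynomial.natDegree_sum_le_of_forall_le _ _ fun l _ => ?_
      rw [Matrix.map_apply]
      exact (Polynomial.natDegree_mul_C_le _ _).trans
        (Finset.le_sup (f := fun j => ((U * G) i j).natDegree) (Finset.mem_univ l))

theorem sum_hammingNorm_coeff_le_weight [DecidableEq F] (v : Fin n → Polynomial F)
    (T : Finset ℕ) : ∑ t ∈ T, hammingNorm (fun j => (v j).coeff t) ≤ weight v := by
  classical
  simp only [hammingNorm, Finset.card_filter, weight]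
  rw [Finset.sum_comm]
  refine Finset.sum_le_sum fun j _ => ?_
  rw [← Finset.card_filter]
  exact Finset.card_le_card fun t ht => Polynomial.mem_support_iff.2 (Finset.mem_filter.1 ht).2

/-- The data of a memory-one convolutional code: the rows `A l + D (B l)`, of degree one exactly
for `l ∈ S`, together with constant matrices `P`, `Q` dual to the trailing and to the leading
coefficients of these rows. -/
structure IsDualPair (A B : Matrix (Fin k) (Fin n) F) (S : Finset (Fin k))
    (P Q : Matrix (Fin n) (Fin k) F) : Prop where
  eq_zero : ∀ l ∉ S, B l = 0
  mul_left : A * P = 1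
  mul_left' : B * P = 0
  mul_right : A * Q = Matrix.diagonal fun l => if l ∈ S then 0 else 1
  mul_right' : B * Q = Matrix.diagonal fun l => if l ∈ S then 1 else 0

variable {A B : Matrix (Fin k) (Fin n) F} {S : Finset (Fin k)} {P Q : Matrix (Fin n) (Fin k) F}

theorem IsDualPair.eq_zero_iff (h : IsDualPair A B S P Q) (l : Fin k) : B l = 0 ↔ l ∉ S := by
  refine ⟨fun h0 hl => ?_, h.eq_zero l⟩
  have := congrFun (congrFun h.mul_right' l) l
  simp [Matrix.mul_apply, h0, hl] at this

theorem IsDualPair.rowDegree (h : IsDualPair A B S P Q) (l : Fin k) :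
    rowDegree (linearEncoder A B) l = if l ∈ S then 1 else 0 := by
  have hG (j) : linearEncoder A B l j =
      Polynomial.C (B l j) * Polynomial.X + Polynomial.C (A l j) := by
    simp only [linearEncoder, Matrix.add_apply, Matrix.smul_apply, Matrix.map_apply, smul_eq_mul,
      add_comm, mul_comm]
  simp only [ConvCode.rowDegree, hG]
  split_ifs with hl
  · obtain ⟨j, hj⟩ := Function.ne_iff.1 (mt (h.eq_zero_iff l).1 (not_not.2 hl))
    refine le_antisymm (Finset.sup_le fun j _ => Polynomial.natDegree_linear_le) ?_
    rw [← Polynomial.natDegree_linear (b := A l j) hj]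
    exact Finset.le_sup (f := fun j =>
      (Polynomial.C (B l j) * Polynomial.X + Polynomial.C (A l j)).natDegree) (Finset.mem_univ j)
  · simp [h.eq_zero l hl]

theorem IsDualPair.constraintLength (h : IsDualPair A B S P Q) :
    constraintLength (linearEncoder A B) = S.card := by
  simp [ConvCode.constraintLength, h.rowDegree]

theorem IsDualPair.memory (h : IsDualPair A B S P Q) (hS : S.Nonempty) :
    memory (linearEncoder A B) = 1 := by
  obtain ⟨l, hl⟩ := hS
  simp only [ConvCode.memory, h.rowDegree]
  refine le_antisymm (Finset.sup_le fun i _ => by split_ifs <;> simp) ?_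
  calc 1 = if l ∈ S then 1 else 0 := by simp [hl]
    _ ≤ _ := Finset.le_sup (f := fun i => if i ∈ S then 1 else 0) (Finset.mem_univ l)

theorem IsDualPair.isReducedBasic (h : IsDualPair A B S P Q) :
    IsReducedBasic (linearEncoder A B) := by
  have hdet : (linearEncoder A B * Q.map Polynomial.C).det = Polynomial.X ^ S.card := by
    have : linearEncoder A B * Q.map Polynomial.C =
        Matrix.diagonal fun l => if l ∈ S then (Polynomial.X : Polynomial F) else 1 := by
      rw [linearEncoder_mul, h.mul_right, h.mul_right']
      ext i j
      by_cases hij : i = j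
      · subst hij
        by_cases hi : i ∈ S <;> simp [hi]
      · simp [hij]
    rw [this, Matrix.det_diagonal, Finset.prod_ite_mem, Finset.univ_inter, Finset.prod_const]
  refine isReducedBasic_of_le_natDegree_det ⟨P.map Polynomial.C, ?_⟩ Q ?_ ?_
  · rw [linearEncoder_mul, h.mul_left, h.mul_left']
    ext i j
    simp [Matrix.one_apply, apply_ite]
  · simp [hdet]
  · simp [hdet, h.constraintLength]

/-- A nonzero word of the code has its trailing coefficient in `C₀`, its leading coefficient
in `C₁`, and if they coincide they lie in both. -/
theorem IsDualPair.le_weight [DecidableEq F] (h : IsDualPair A B S P Q)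
    {C₀ C₁ : Submodule F (Fin n → F)} (hA₀ : ∀ l, A l ∈ C₀) (hA₁ : ∀ l ∉ S, A l ∈ C₁)
    (hB₁ : ∀ l, B l ∈ C₁) {d₀ d₁ d : ℕ} (hd₀ : ∀ v ∈ C₀, v ≠ 0 → d₀ ≤ hammingNorm v)
    (hd₁ : ∀ v ∈ C₁, v ≠ 0 → d₁ ≤ hammingNorm v) (hd : d ≤ d₀ + d₁)
    (hd' : ∀ v ∈ C₀ ⊓ C₁, v ≠ 0 → d ≤ hammingNorm v) {v : Fin n → Polynomial F}
    (hv : v ∈ code (linearEncoder A B)) (hv0 : v ≠ 0) : d ≤ weight v := by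
  classical
  obtain ⟨u, rfl⟩ := hv
  set v := (linearEncoder A B).vecMulLinear u with hvdef
  let c (t : ℕ) : Fin n → F := fun j => (v j).coeff t
  let a (t : ℕ) : Fin k → F := fun l => (u l).coeff t
  have hc0 : c 0 = Matrix.vecMul (a 0) A := by
    ext j
    simp [c, a, hvdef, Matrix.vecMul, dotProduct, linearEncoder]
  have hcs (t) : c (t + 1) = Matrix.vecMul (a (t + 1)) A + Matrix.vecMul (a t) B := by
    ext j
    simp [c, a, hvdef, Matrix.vecMul, dotProduct, linearEncoder]
  -- `P` reads each coefficient of the input off the same coefficient of the codeword, so the input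
  -- vanishes wherever the codeword does.
  have hcP (t) : Matrix.vecMul (c t) P = a t := by
    cases t with
    | zero => rw [hc0, Matrix.vecMul_vecMul, h.mul_left, Matrix.vecMul_one]
    | succ t =>
      rw [hcs, Matrix.add_vecMul, Matrix.vecMul_vecMul, Matrix.vecMul_vecMul, h.mul_left,
        h.mul_left', Matrix.vecMul_one, Matrix.vecMul_zero, add_zero]
  have ha (t) (ht : c t = 0) : a t = 0 := by rw [← hcP, ht, Matrix.zero_vecMul]
  have hmemA (w : Fin k → F) : Matrix.vecMul w A ∈ C₀ := by
    rw [Matrix.vecMul_eq_sum]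
    exact C₀.sum_mem fun l _ => C₀.smul_mem _ (hA₀ l)
  have hmemB (w : Fin k → F) : Matrix.vecMul w B ∈ C₁ := by
    rw [Matrix.vecMul_eq_sum]
    exact C₁.sum_mem fun l _ => C₁.smul_mem _ (hB₁ l)
  -- Since `B * Q` is the indicator of `S` on the diagonal, `w B = 0` forces `w` to vanish on `S`,
  -- leaving only rows of `A` that lie in `C₁`.
  have hmemA₁ (w : Fin k → F) (hw : Matrix.vecMul w B = 0) : Matrix.vecMul w A ∈ C₁ := by
    rw [Matrix.vecMul_eq_sum]
    refine C₁.sum_mem fun l _ => ?_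
    by_cases hl : l ∈ S
    · have h0 := congrArg (fun y => Matrix.vecMul y Q l) hw
      simp only [Matrix.vecMul_vecMul, h.mul_right', Matrix.zero_vecMul,
        Matrix.vecMul_diagonal] at h0
      have : w l = 0 := by simpa [hl] using h0
      simp [this]
    · exact C₁.smul_mem _ (hA₁ l hl)
  let s : Finset ℕ := Finset.univ.biUnion fun j => (v j).support
  have hs (t) : t ∈ s ↔ c t ≠ 0 := by simp [s, c, Function.ne_iff]
  have hsne : s.Nonempty := by
    obtain ⟨j, hj⟩ := Function.ne_iff.1 hv0
    exact ⟨_, Finset.mem_biUnion.2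
      ⟨j, Finset.mem_univ _, Polynomial.natDegree_mem_support_of_nonzero hj⟩⟩
  have hmin (t) (ht : t < s.min' hsne) : c t = 0 := by
    by_contra hne
    exact ht.not_ge (s.min'_le t ((hs t).2 hne))
  have hmax (t) (ht : s.max' hsne < t) : c t = 0 := by
    by_contra hne
    exact ht.not_ge (s.le_max' t ((hs t).2 hne))
  have hcmin := (hs _).1 (s.min'_mem hsne)
  have hcmax := (hs _).1 (s.max'_mem hsne)
  have hmin₀ : c (s.min' hsne) ∈ C₀ := by
    revert hmin
    cases s.min' hsne with
    | zero => intro; rw [hc0]; exact hmemA _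
    | succ t =>
      intro hmin
      rw [hcs, ha t (hmin t t.lt_succ_self), Matrix.zero_vecMul, add_zero]
      exact hmemA _
  have hmax₁ : c (s.max' hsne) ∈ C₁ := by
    -- The next codeword coefficient and the next input coefficient both vanish, so the recursion
    -- leaves only this term.
    have hB : Matrix.vecMul (a (s.max' hsne)) B = 0 := by
      have h1 := hmax _ (Nat.lt_succ_self _)
      have h2 := hcs (s.max' hsne)
      rwa [h1, ha _ h1, Matrix.zero_vecMul, zero_add, eq_comm] at h2
    revert hB
    cases s.max' hsne with
    | zero => intro hB; rw [hc0]; exact hmemA₁ _ hB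
    | succ t => intro hB; rw [hcs]; exact C₁.add_mem (hmemA₁ _ hB) (hmemB _)
  by_cases heq : s.min' hsne = s.max' hsne
  · refine (hd' _ ⟨hmin₀, heq ▸ hmax₁⟩ hcmin).trans ?_
    simpa using sum_hammingNorm_coeff_le_weight v {s.min' hsne}
  · refine hd.trans ((add_le_add (hd₀ _ hmin₀ hcmin) (hd₁ _ hmax₁ hcmax)).trans ?_)
    have := sum_hammingNorm_coeff_le_weight v {s.min' hsne, s.max' hsne}
    rwa [Finset.sum_pair heq] at this

end

end ConvCode

/-! ### From two block codes to a convolutional code. -/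

namespace ConvCode

theorem exists_isDualPair {F : Type*} [Field F] {n k g r : ℕ} {C₀ C₁ : Submodule F (Fin n → F)}
    (hr : finrank F ↥(C₀ ⊓ C₁) = r) (h₀ : r + g ≤ finrank F C₀) (h₁ : r + g ≤ finrank F C₁)
    (hk : k = r + g) :
    ∃ (A B : Matrix (Fin k) (Fin n) F) (S : Finset (Fin k)) (P Q : Matrix (Fin n) (Fin k) F),
      IsDualPair A B S P Q ∧ S.card = g ∧ (∀ l, A l ∈ C₀) ∧ (∀ l ∉ S, A l ∈ C₁) ∧
      ∀ l, B l ∈ C₁ := by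
  obtain ⟨z, f, e, hz, hf, he, hli⟩ := Submodule.exists_linearIndependent_of_inf hr h₀ h₁
  obtain ⟨c, hc⟩ := hli.exists_dotProduct_eq
  let σ : Fin k ≃ Fin r ⊕ Fin g := (finCongr hk).trans finSumFinEquiv.symm
  let A : Matrix (Fin k) (Fin n) F := fun l => Sum.elim z f (σ l)
  let B : Matrix (Fin k) (Fin n) F := fun l => Sum.elim (fun _ => 0) e (σ l)
  let S : Finset (Fin k) := Finset.univ.map (Function.Embedding.inr.trans σ.symm.toEmbedding)
  -- `P` is dual to `z, f` and `Q` to `z, e`. Both come from one dual family of `z, f, e`, so `P`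
  -- kills `e` and `Q` kills `f`.
  let P : Matrix (Fin n) (Fin k) F :=
    fun j l => Sum.elim (fun i => c (.inl i)) (fun i => c (.inr (.inl i))) (σ l) j
  let Q : Matrix (Fin n) (Fin k) F :=
    fun j l => Sum.elim (fun i => c (.inl i)) (fun i => c (.inr (.inr i))) (σ l) j
  have hS (x) : σ.symm x ∈ S ↔ x.isRight := by
    rcases x with x | x <;> simp [S]
  have hdot (w : Fin r ⊕ Fin g ⊕ Fin g) (y) :
      ∑ j, Sum.elim z (Sum.elim f e) w j * c y j = if w = y then 1 else 0 := hc w y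
  have hz' (i y) : ∑ j, z i j * c y j = if .inl i = y then 1 else 0 := hdot (.inl i) y
  have hf' (i y) : ∑ j, f i j * c y j = if .inr (.inl i) = y then 1 else 0 :=
    hdot (.inr (.inl i)) y
  have he' (i y) : ∑ j, e i j * c y j = if .inr (.inr i) = y then 1 else 0 :=
    hdot (.inr (.inr i)) y
  refine ⟨A, B, S, P, Q, ⟨?_, ?_, ?_, ?_, ?_⟩, by simp [S], ?_, ?_, ?_⟩
  · refine σ.symm.surjective.forall.2 fun x hx => ?_
    rcases x with x | x
    · ext; simp [B]
    · exact absurd ((hS _).2 rfl) hx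
  · ext l m
    obtain ⟨x, rfl⟩ := σ.symm.surjective l
    obtain ⟨y, rfl⟩ := σ.symm.surjective m
    rw [Matrix.mul_apply]
    rcases x with x | x <;> rcases y with y | y <;>
      simp [Matrix.one_apply, A, P, hz', hf']
  · ext l m
    obtain ⟨x, rfl⟩ := σ.symm.surjective l
    obtain ⟨y, rfl⟩ := σ.symm.surjective m
    rw [Matrix.mul_apply]
    rcases x with x | x <;> rcases y with y | y <;>
      simp [B, P, he']
  · ext l m
    obtain ⟨x, rfl⟩ := σ.symm.surjective l
    obtain ⟨y, rfl⟩ := σ.symm.surjective m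
    rw [Matrix.mul_apply]
    rcases x with x | x <;> rcases y with y | y <;>
      simp [Matrix.diagonal_apply, A, Q, hz', hf', hS]
  · ext l m
    obtain ⟨x, rfl⟩ := σ.symm.surjective l
    obtain ⟨y, rfl⟩ := σ.symm.surjective m
    rw [Matrix.mul_apply]
    rcases x with x | x <;> rcases y with y | y <;>
      simp [Matrix.diagonal_apply, B, Q, he', hS]
  · refine σ.symm.surjective.forall.2 fun x => ?_
    rcases x with x | x
    · simpa [A] using (hz x).1
    · simpa [A] using hf x
  · refine σ.symm.surjective.forall.2 fun x hx => ?_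
    rcases x with x | x
    · simpa [A] using (hz x).2
    · exact absurd ((hS _).2 rfl) hx
  · refine σ.symm.surjective.forall.2 fun x => ?_
    rcases x with x | x
    · simp [B]
    · simpa [B] using he x

/-- Two block codes `C₀`, `C₁` give a convolutional code of memory one with free distance at least
`min (d₀ + d₁) (d (C₀ ⊓ C₁))`. -/
theorem exists_hasParameters_one {F : Type*} [Field F] [DecidableEq F] {n k g r : ℕ}
    {C₀ C₁ : Submodule F (Fin n → F)}
    (hr : finrank F ↥(C₀ ⊓ C₁) = r) (h₀ : r + g ≤ finrank F C₀) (h₁ : r + g ≤ finrank F C₁)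
    (hk : k = r + g) (hg : 0 < g) {d₀ d₁ d : ℕ} (hd₀ : ∀ v ∈ C₀, v ≠ 0 → d₀ ≤ hammingNorm v)
    (hd₁ : ∀ v ∈ C₁, v ≠ 0 → d₁ ≤ hammingNorm v) (hd : d ≤ d₀ + d₁)
    (hd' : ∀ v ∈ C₀ ⊓ C₁, v ≠ 0 → d ≤ hammingNorm v) :
    ∃ (C : Submodule (Polynomial F) (Fin n → Polynomial F)) (d' : ℕ),
      HasParameters C k g 1 d' ∧ d ≤ d' := by
  obtain ⟨A, B, S, P, Q, h, hS, hA₀, hA₁, hB₁⟩ := exists_isDualPair hr h₀ h₁ hk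
  have hSne : S.Nonempty := Finset.card_pos.1 (hS ▸ hg)
  refine ⟨code (linearEncoder A B), _, ⟨⟨_, h.isReducedBasic, rfl, h.constraintLength.trans hS,
    h.memory hSne⟩, rfl⟩, le_csInf ?_ ?_⟩
  -- In `ℕ` the infimum of the empty set is `0`, so a nonzero codeword is needed: a row of degree
  -- one is such a word.
  · obtain ⟨l, hl⟩ := hSne
    refine ⟨_, linearEncoder A B l, ⟨Pi.single l 1, by ext; simp⟩, fun h0 => ?_, rfl⟩
    have h1 := h.rowDegree l
    rw [if_pos hl, ConvCode.rowDegree, h0] at h1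
    have h2 : (Finset.univ.sup fun j => ((0 : Fin n → Polynomial F) j).natDegree) ≤ 0 :=
      Finset.sup_le fun j _ => by simp
    omega
  · rintro _ ⟨v, hv, hv0, rfl⟩
    exact h.le_weight hA₀ hA₁ hB₁ hd₀ hd₁ hd hd' hv hv0

/-! ### Hooks of digit pairs, and dimensions of power-sum codes. -/

/-- The pairs of natural numbers in `[a, b)` with minimum `a`. -/
def hook (a b : ℕ) : Finset (ℕ × ℕ) :=
  Finset.Ico a b ×ˢ Finset.Ico a b \ Finset.Ico (a + 1) b ×ˢ Finset.Ico (a + 1) b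

theorem mem_hook {a b : ℕ} {p : ℕ × ℕ} :
    p ∈ hook a b ↔ a ≤ p.1 ∧ a ≤ p.2 ∧ p.1 < b ∧ p.2 < b ∧ (p.1 = a ∨ p.2 = a) := by
  simp only [hook, Finset.mem_sdiff, Finset.mem_product, Finset.mem_Ico]
  omega

theorem card_hook_add_one_le (a m : ℕ) : (hook a (a + (m + 1))).card ≤ 2 * m + 1 := by
  rw [hook, Finset.card_sdiff_of_subset
    (Finset.product_subset_product (Finset.Ico_subset_Ico_left (by omega))
      (Finset.Ico_subset_Ico_left (by omega)))]
  simp only [Finset.card_product, Nat.card_Ico]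
  rw [show a + (m + 1) - a = m + 1 by omega, show a + (m + 1) - (a + 1) = m by omega,
    Nat.sub_le_iff_le_add]
  exact le_of_eq (by ring)

section

variable {F K : Type*} [Field F] [Fintype F] [Field K] [Algebra F K] {n : ℕ}

theorem lt_hammingNorm_of_mem_powerSumCode [DecidableEq F] {x : Fin n → K}
    (hx : Function.Injective x) (hx0 : ∀ j, x j ≠ 0) {T : Finset (ℕ × ℕ)} (b m : ℕ)
    (hT : ∀ s < m, ((b + s) % Fintype.card F, (b + s) / Fintype.card F) ∈ T) {v : Fin n → F}
    (hvT : v ∈ powerSumCode F x T) (hv : v ≠ 0) : m < hammingNorm v := by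
  refine lt_hammingNorm_of_powerSums_eq_zero hx hx0 hv b m fun s hs => ?_
  have := mem_powerSumCode.1 hvT _ (hT s hs)
  rwa [Nat.mod_add_div] at this

/-- All power sums together determine a word, so the codes of complementary sets of exponents have
complementary dimensions at most. -/
theorem finrank_powerSumCode_le [Fintype K] (h2 : finrank F K = 2)
    (hK : Fintype.card K = Fintype.card F ^ 2) {x : Fin n → K}
    (hx : Function.Injective x) (hx0 : ∀ j, x j ≠ 0) {S T : Finset (ℕ × ℕ)}
    (hT : ∀ p ∈ T, p.swap ∈ T)
    (hST : ∀ s < n, (s % Fintype.card F, s / Fintype.card F) ∈ S ∪ T) :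
    finrank F (powerSumCode F x S) ≤ T.card := by
  classical
  have hbot : powerSumCode F x S ⊓ powerSumCode F x T = ⊥ := by
    rw [← powerSumCode_union, eq_bot_iff]
    intro v hv
    by_contra hv0
    refine (lt_hammingNorm_of_mem_powerSumCode hx hx0 0 n (by simpa using hST) hv hv0).not_ge ?_
    simpa using hammingNorm_le_card_fintype (x := v)
  have h := Submodule.finrank_sup_add_finrank_inf_eq (powerSumCode F x S) (powerSumCode F x T)
  have h' := (powerSumCode F x S ⊔ powerSumCode F x T).finrank_le
  have h'' := le_finrank_powerSumCode h2 hK x hT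
  rw [hbot, finrank_bot] at h
  rw [finrank_fin_fun] at h'
  omega

end

theorem exists_quadraticExtension (F : Type*) [Field F] [Fintype F] :
    ∃ (K : Type) (_ : Field K) (_ : Fintype K) (_ : Algebra F K),
      finrank F K = 2 ∧ Fintype.card K = Fintype.card F ^ 2 := by
  obtain ⟨p, hp⟩ := CharP.exists F
  have : Fact p.Prime := ⟨CharP.char_is_prime F p⟩
  let _ : Fintype (FiniteField.Extension F p 2) := Fintype.ofFinite _
  refine ⟨FiniteField.Extension F p 2, inferInstance, inferInstance, inferInstance,
    FiniteField.finrank_extension F p 2, ?_⟩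
  rw [← Nat.card_eq_fintype_card, ← Nat.card_eq_fintype_card, FiniteField.natCard_extension]

end ConvCode

/-! ### The choice of exponents and the main theorem. -/

open ConvCode in
theorem mainTheorem7 (q : ℕ) (hq : IsPrimePow q) (hq4 : 4 ≤ q)
    (F : Type*) [Field F] [Fintype F] (hF : Fintype.card F = q)
    (n : ℕ) (hn : n = q ^ 2 - 1) (i : ℕ) (hi1 : 1 ≤ i) (hi2 : i ≤ q - 3) :
    ∃ (C : Submodule (Polynomial F) (Fin n → Polynomial F)) (d : ℕ),
      ConvCode.HasParameters C (n - 2 * (q + i)) (2 * (q - 2 - i)) 1 d ∧ 2 * q + 1 ≤ d := by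
  classical
  obtain ⟨K, _, _, _, h2, hK⟩ := exists_quadraticExtension F
  obtain ⟨x, hx, hx0⟩ : ∃ x : Fin n → K, Function.Injective x ∧ ∀ j, x j ≠ 0 := by
    have hc : Fintype.card Kˣ = n := by rw [Fintype.card_units, hK, hF, hn]
    refine ⟨fun j => ((Fintype.equivFinOfCardEq hc).symm j : K), ?_, fun j => Units.ne_zero _⟩
    exact Units.val_injective.comp (Equiv.injective _)
  obtain ⟨m, rfl⟩ : ∃ m, q = m + 4 := ⟨q - 4, by omega⟩
  -- Both sets have at most `2(q+i)` elements: `(2q-1) + (2i+1)` and `(2q-3) + (2i+3)`. Each short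
  -- hook lies in the long hook of the other set, so the union is just the two long hooks, with at
  -- most `4q-4` elements.
  set T₀ := hook 0 (m + 4) ∪ hook 1 (i + 2) with hT₀
  set T₁ := hook 1 (m + 4) ∪ hook 0 (i + 2) with hT₁
  -- The digit pairs outside both long hooks. The pair `(q-1, q-1)` is removed because it encodes `q
  -- ^ 2 - 1 = n`, while only exponents below `n` are needed; this makes the upper bound on the
  -- dimension sharp.
  set T' := (Finset.Ico 2 (m + 4) ×ˢ Finset.Ico 2 (m + 4)).erase (m + 3, m + 3) with hT'
  have hn' : n = m ^ 2 + 8 * m + 15 := by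
    rw [hn, show (m + 4) ^ 2 = m ^ 2 + 8 * m + 15 + 1 by ring, Nat.add_sub_cancel]
  have hswap₀ : ∀ p ∈ T₀, p.swap ∈ T₀ := by
    simp only [hT₀, Finset.mem_union, mem_hook, Prod.fst_swap, Prod.snd_swap]
    omega
  have hswap₁ : ∀ p ∈ T₁, p.swap ∈ T₁ := by
    simp only [hT₁, Finset.mem_union, mem_hook, Prod.fst_swap, Prod.snd_swap]
    omega
  have hswap : ∀ p ∈ T₀ ∪ T₁, p.swap ∈ T₀ ∪ T₁ := by
    intro p hp
    rw [Finset.mem_union] at hp ⊢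
    exact hp.imp (hswap₀ p) (hswap₁ p)
  have hswap' : ∀ p ∈ T', p.swap ∈ T' := by
    simp only [hT', Finset.mem_erase, Finset.mem_product, Finset.mem_Ico, Prod.fst_swap,
      Prod.snd_swap, ne_eq, Prod.ext_iff]
    omega
  have hhook (a b) (hab : a < b) : (hook a b).card ≤ 2 * (b - a) - 1 := by
    have h := card_hook_add_one_le a (b - a - 1)
    rw [show a + (b - a - 1 + 1) = b by omega] at h
    omega
  have hq0 := hhook 0 (m + 4) (by omega)
  have hq1 := hhook 1 (m + 4) (by omega)
  have hi₀ := hhook 0 (i + 2) (by omega)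
  have hi₁ := hhook 1 (i + 2) (by omega)
  have hcard₀ : T₀.card ≤ 2 * (m + 4 + i) := by
    have : T₀.card ≤ _ := Finset.card_union_le _ _
    omega
  have hcard₁ : T₁.card ≤ 2 * (m + 4 + i) := by
    have : T₁.card ≤ _ := Finset.card_union_le _ _
    omega
  have hcard : (T₀ ∪ T₁).card ≤ 4 * m + 12 := by
    have hsub : T₀ ∪ T₁ ⊆ hook 0 (m + 4) ∪ hook 1 (m + 4) := by
      intro p
      simp only [hT₀, hT₁, Finset.mem_union, mem_hook]
      omega
    have := Finset.card_le_card hsub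
    have := Finset.card_union_le (hook 0 (m + 4)) (hook 1 (m + 4))
    omega
  have hcard' : T'.card = m ^ 2 + 4 * m + 3 := by
    rw [hT', Finset.card_erase_of_mem (by simp), Finset.card_product, Nat.card_Ico,
      show m + 4 - 2 = m + 2 by omega, show (m + 2) * (m + 2) = m ^ 2 + 4 * m + 3 + 1 by ring,
      Nat.add_sub_cancel]
  have hr : finrank F ↥(powerSumCode F x T₀ ⊓ powerSumCode F x T₁) = m ^ 2 + 4 * m + 3 := by
    rw [← powerSumCode_union]
    refine le_antisymm ?_ ?_
    · rw [← hcard']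
      refine finrank_powerSumCode_le h2 hK hx hx0 hswap' fun s hs => ?_
      have hmod := Nat.mod_lt s (show 0 < m + 4 by omega)
      have hdiv : s / (m + 4) < m + 4 := Nat.div_lt_of_lt_mul (by nlinarith)
      have hs' := Nat.mod_add_div s (m + 4)
      have hne : ¬ (s % (m + 4) = m + 3 ∧ s / (m + 4) = m + 3) := by
        rintro ⟨h1, h2⟩
        rw [h1, h2] at hs'
        nlinarith
      rw [hF]
      simp only [hT₀, hT₁, hT', Finset.mem_union, mem_hook, Finset.mem_erase, Finset.mem_product,
        Finset.mem_Ico, ne_eq, Prod.mk.injEq]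
      clear hs'
      generalize s % (m + 4) = a at *
      generalize s / (m + 4) = b at *
      omega
    · have := le_finrank_powerSumCode h2 hK x hswap
      omega
  have h₀ := le_finrank_powerSumCode h2 hK x hswap₀
  have h₁ := le_finrank_powerSumCode h2 hK x hswap₁
  refine exists_hasParameters_one (d₀ := m + 4 + 1) (d₁ := m + 4 + 1) hr (by omega) (by omega)
    (by omega) (by omega) ?_ ?_ (by omega) ?_
  · refine fun v hv hv0 => lt_hammingNorm_of_mem_powerSumCode hx hx0 0 (m + 4) (fun s hs => ?_)
      hv hv0
    rw [hF, zero_add, Nat.mod_eq_of_lt hs, Nat.div_eq_of_lt hs]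
    simp only [hT₀, Finset.mem_union, mem_hook, or_true, and_true]
    omega
  -- The exponents `q, …, 2q-1` have second digit `1`. All lie in `hook 1 q` except `q` itself, the
  -- pair `(0, 1)`, which the short hook at `0` supplies.
  · refine fun v hv hv0 => lt_hammingNorm_of_mem_powerSumCode hx hx0 (m + 4) (m + 4)
      (fun s hs => ?_) hv hv0
    rw [hF, Nat.add_mod_left, Nat.add_div_left _ (by omega), Nat.mod_eq_of_lt hs,
      Nat.div_eq_of_lt hs]
    simp only [hT₁, Finset.mem_union, mem_hook, zero_add, or_true, and_true]
    omega
  · intro v hv hv0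
    rw [← powerSumCode_union] at hv
    refine lt_hammingNorm_of_mem_powerSumCode hx hx0 0 (2 * (m + 4)) (fun s hs => ?_) hv hv0
    have hmod := Nat.mod_lt s (show 0 < m + 4 by omega)
    have hdiv : s / (m + 4) < 2 := Nat.div_lt_of_lt_mul (by omega)
    rw [hF, zero_add]
    simp only [hT₀, hT₁, Finset.mem_union, mem_hook]
    generalize s % (m + 4) = a at *
    generalize s / (m + 4) = b at *
    omega
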